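/- For $\beta\in(1,2)$ let $T_\beta(x)=\beta x \pmod 1$ be the $\beta$-transformation on $[0,1)$ and let $$E_\beta^+=\{t\in[0,1):\ T_\beta^n(t)\ge t\ \text{ for all } n\ge 0\}.$$ Then the set of $\beta\in(1,2)$ for which the topological closure $\overline{E_\beta^+}$ is a Cantor set (that is, a non-empty compact, perfect and totally disconnected set) has Hausdorff dimension zero: $$\dim_H\big(\{\beta\in(1,2):\ \overline{E_\beta^+}\text{ is a Cantor set}\}\big)=0.$$ -/

import Mathlib

/-- The `β`-transformation `T_β(x) = β x (mod 1)`. -/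
noncomputable def betaMap (β : ℝ) (x : ℝ) : ℝ := Int.fract (β * x)

/-- `E_β^+ = {t ∈ [0,1) : T_β^n(t) ≥ t for all n ≥ 0}`. -/
def bifurcationSetPlus (β : ℝ) : Set ℝ :=
  {t : ℝ | t ∈ Set.Ico (0 : ℝ) 1 ∧ ∀ n : ℕ, t ≤ (betaMap β)^[n] t}

/-- A Cantor set: a non-empty compact set that is perfect (closed, without isolated points) and
totally disconnected. -/
structure IsCantorSet {X : Type*} [TopologicalSpace X] (C : Set X) : Prop where
  nonempty : C.Nonempty
  isCompact : IsCompact C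
  perfect : Perfect C
  isTotallyDisconnected : IsTotallyDisconnected C

/-!
Making `T_β` constant, with value `β - 1`, on the plateau `[0, 1 - 1/β]` turns it into a monotone
circle map of degree one, to which rotation theory applies.

Suppose the orbit of the plateau returns to the interior of the plateau. The intermediate value
theorem then produces a periodic orbit of `T_β` that avoids the plateau. The smallest point `t` of
that orbit lies in `E_β^+`, and it is isolated there. Points `s` just below `t` are pushed below
themselves when the orbit of `t` closes up. For `s` so close above `t` that no point of the orbit of
`t` lies in `(t, s)`, expansion separates the integer parts of the lifted orbits of `t` and `s` at
some time, and by monotonicity the iterate of `s` then falls in `[0, t]` modulo `1`. So the closure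
of `E_β^+` is not perfect.

Otherwise either some iterate of the plateau hits an integer, which by strict monotonicity in `β`
happens for countably many `β` only, or the orbit never returns to the plateau. In the latter case
the integer parts of the first `N` lifted iterates are `⌊n a / b⌋` for some rational `a / b` with
`b ≤ N`, leaving `O(N²)` possibilities, while parameters sharing them differ by at most `β^(1-N)`.
-/

open Asymptotics Filter Function MeasureTheory Metric Set Topology

section Covering

theorem dimH_eq_zero_of_polynomial_cover {X : Type*} [EMetricSpace X] {S : Set X} {r : ℝ}
    (hr₀ : 0 ≤ r) (hr₁ : r < 1) {d : ℕ} {ι : ℕ → Type*} [∀ N, Fintype (ι N)]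
    (hcard : (fun N ↦ (Fintype.card (ι N) : ℝ)) =O[atTop] fun N ↦ (N : ℝ) ^ d)
    (U : ∀ N, ι N → Set X) (hU : ∀ N i, ediam (U N i) ≤ ENNReal.ofReal (r ^ N))
    (hS : ∀ N, S ⊆ ⋃ i, U N i) : dimH S = 0 := by
  borelize X
  refine le_antisymm (ENNReal.le_of_forall_pos_le_add fun s hs _ ↦ ?_) bot_le
  rw [zero_add]
  have hs' : (0 : ℝ) < s := hs
  have hsum (N : ℕ) : ∑ i, ediam (U N i) ^ (s : ℝ) ≤
      ENNReal.ofReal (Fintype.card (ι N) * (r ^ (s : ℝ)) ^ N) :=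
    calc ∑ i, ediam (U N i) ^ (s : ℝ)
        ≤ ∑ _i : ι N, ENNReal.ofReal (r ^ N) ^ (s : ℝ) := by
          gcongr with i
          exact hU N i
      _ = ENNReal.ofReal (Fintype.card (ι N) * (r ^ (s : ℝ)) ^ N) := by
          rw [ENNReal.ofReal_rpow_of_nonneg (by positivity) hs'.le, ← Real.rpow_pow_comm hr₀,
            ENNReal.ofReal_mul (by positivity), ENNReal.ofReal_natCast, Finset.sum_const,
            nsmul_eq_mul, Finset.card_univ]
  have hlim : Tendsto (fun N ↦ ENNReal.ofReal (Fintype.card (ι N) * (r ^ (s : ℝ)) ^ N))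
      atTop (𝓝 0) := by
    rw [← ENNReal.ofReal_zero]
    exact ENNReal.tendsto_ofReal <| (hcard.mul (isBigO_refl _ _)).trans_tendsto <|
      tendsto_pow_const_mul_const_pow_of_lt_one d (by positivity) (Real.rpow_lt_one hr₀ hr₁ hs')
  have hdiam : Tendsto (fun N ↦ ENNReal.ofReal (r ^ N)) atTop (𝓝 0) := by
    rw [← ENNReal.ofReal_zero]
    exact ENNReal.tendsto_ofReal (tendsto_pow_atTop_nhds_zero_of_lt_one hr₀ hr₁)
  have hzero : Measure.hausdorffMeasure (s : ℝ) S ≤ 0 :=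
    calc Measure.hausdorffMeasure (s : ℝ) S
        ≤ liminf (fun N ↦ ∑ i, ediam (U N i) ^ (s : ℝ)) atTop :=
          Measure.hausdorffMeasure_le_liminf_sum _ _ _ hdiam U (.of_forall hU) (.of_forall hS)
      _ ≤ liminf (fun N ↦ ENNReal.ofReal (Fintype.card (ι N) * (r ^ (s : ℝ)) ^ N)) atTop :=
          liminf_le_liminf (.of_forall hsum)
      _ = 0 := hlim.liminf_eq
  exact dimH_le_of_hausdorffMeasure_ne_top (hzero.trans_lt ENNReal.zero_lt_top).ne

end Covering

section FirstHit

variable {α δ : Type*} [ConditionallyCompleteLinearOrder α] [TopologicalSpace α] [OrderTopology α]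
  [DenselyOrdered α] [LinearOrder δ] [TopologicalSpace δ] [OrderClosedTopology δ]

theorem exists_first_eq_of_continuousOn {f : α → δ} {a b : α} {c : δ} (hab : a ≤ b)
    (hf : ContinuousOn f (Icc a b)) (ha : f a < c) (hb : c ≤ f b) :
    ∃ y ∈ Ioc a b, f y = c ∧ ∀ x ∈ Ico a y, f x < c := by
  obtain ⟨y, ⟨hy, hyc⟩, hleast⟩ : ∃ y, IsLeast (Icc a b ∩ f ⁻¹' {c}) y := by
    refine IsCompact.exists_isLeast ?_ (intermediate_value_Icc hab hf ⟨ha.le, hb⟩)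
    exact isCompact_Icc.of_isClosed_subset
      (hf.preimage_isClosed_of_isClosed isClosed_Icc isClosed_singleton) inter_subset_left
  refine ⟨y, ⟨hy.1.lt_of_ne ?_, hy.2⟩, hyc, fun x hx ↦ ?_⟩
  · rintro rfl
    exact ha.ne hyc
  · by_contra! hx'
    have hxb : x ≤ b := hx.2.le.trans hy.2
    obtain ⟨z, hz, hzc⟩ := intermediate_value_Icc hx.1 (hf.mono (Icc_subset_Icc_right hxb))
      ⟨ha.le, hx'⟩
    exact (hz.2.trans_lt hx.2).not_ge (hleast ⟨⟨hz.1, hz.2.trans hxb⟩, hzc⟩)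

end FirstHit

section CircleLift

variable (f : CircleDeg1Lift) {x y t s : ℝ} {m n : ℕ} {K : ℤ}

theorem mul_lt_mul_of_add_int_le_iterate {k l : ℤ} (hm : m ≠ 0) (hk : x + k ≤ f^[m] x)
    (hl : f^[n] x < x + l) : k * n < l * m := by
  rw [← CircleDeg1Lift.coe_pow] at hk hl
  have hlower := (f ^ m).le_iterate_of_add_int_le_map hk n
  have hupper := ((f ^ n).iterate_pos_lt_iff (pos_of_ne_zero hm)).2 hl
  rw [CircleDeg1Lift.coe_pow, ← iterate_mul] at hlower hupper
  rw [mul_comm n m] at hupper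
  have : (k * n : ℝ) < l * m := by linarith
  exact_mod_cast this

theorem exists_floor_iterate_sub_eq_div {M N : ℕ} (hN : N ≠ 0) (hx : x ≤ f x) (hM : f x ≤ x + M) :
    ∃ a ≤ N * M, ∃ b ≤ N, ∀ n ∈ Finset.Icc 1 N, ⌊f^[n] x - x⌋ = (n * a / b : ℕ) := by
  -- `a / b` is the largest of the lower bounds `⌊f^[n] x - x⌋ / n`, `n ≤ N`, for the translation
  -- number.
  obtain ⟨b, hb, hmax⟩ := (Finset.Icc 1 N).exists_max_image
    (fun n : ℕ ↦ (⌊f^[n] x - x⌋ : ℚ) / n) ⟨1, by simpa [Nat.one_le_iff_ne_zero] using hN⟩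
  rw [Finset.mem_Icc] at hb
  have hb₀ : (0 : ℚ) < b := by exact_mod_cast hb.1
  have hnonneg : 0 ≤ ⌊f^[b] x - x⌋ := by
    have := f.le_iterate_of_add_int_le_map (m := 0) (by simpa using hx) b
    exact Int.floor_nonneg.2 (by simpa using this)
  obtain ⟨a, ha⟩ := Int.eq_ofNat_of_zero_le hnonneg
  have haN : a ≤ b * M := by
    have h := f.iterate_le_of_map_le_add_int (m := M) (by simpa using hM) b
    have : (⌊f^[b] x - x⌋ : ℝ) ≤ b * M := (Int.floor_le _).trans (by simpa [add_comm] using h)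
    rw [ha] at this
    exact_mod_cast this
  refine ⟨a, haN.trans (Nat.mul_le_mul_right M hb.2), b, hb.2, fun n hn ↦ ?_⟩
  have hn₀ : (0 : ℚ) < n := by exact_mod_cast (Finset.mem_Icc.1 hn).1
  have hlower : ⌊f^[n] x - x⌋ * b ≤ a * n := by
    have := hmax n hn
    rw [div_le_div_iff₀ hn₀ hb₀, ha] at this
    exact_mod_cast this
  have hupper : (a : ℤ) * n < (⌊f^[n] x - x⌋ + 1) * b := by
    refine mul_lt_mul_of_add_int_le_iterate f (x := x) (by lia) ?_ ?_
    · rw [← ha]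
      linarith [Int.floor_le (f^[b] x - x)]
    · push_cast
      linarith [Int.lt_floor_add_one (f^[n] x - x)]
  push_cast
  rw [eq_comm, Int.ediv_eq_iff_of_pos (by exact_mod_cast hb₀)]
  constructor <;> linarith

theorem iterate_lt_iterate_of_map_le_of_le_map (hm : m ≠ 0) (hxy : x < y)
    (hx : f^[m] x ≤ x + K) (hy : y + K ≤ f^[m] y) (i : ℕ) : f^[i] x < f^[i] y := by
  by_contra! hle
  obtain ⟨j, hj⟩ := Nat.exists_eq_add_of_le' (Nat.le_mul_of_pos_left i (pos_of_ne_zero hm))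
  rw [← CircleDeg1Lift.coe_pow] at hx hy
  have : f^[m * i] y ≤ f^[m * i] x := by
    rw [hj, iterate_add_apply, iterate_add_apply]
    exact f.monotone.iterate j hle
  have hx' := (f ^ m).iterate_le_of_map_le_add_int hx i
  have hy' := (f ^ m).le_iterate_of_add_int_le_map hy i
  rw [CircleDeg1Lift.coe_pow, ← iterate_mul] at hx' hy'
  linarith

theorem iterate_le_add_int_of_gap (hm : m ≠ 0) (ht : f^[m] t = t + K)
    (hgap : ∀ (i : ℕ) (j : ℤ), t < f^[i] t + j → s ≤ f^[i] t + j) {k : ℕ} {l : ℤ}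
    (hk : f^[k] t < t + l) : f^[k] s ≤ t + l := by
  obtain ⟨i, hi⟩ := Nat.exists_eq_add_of_le (Nat.le_mul_of_pos_left k (pos_of_ne_zero hm))
  have hpre : f^[k] (f^[i] t + (l - k * K : ℤ)) = t + l := by
    have hper := (f ^ m).iterate_eq_of_map_eq_add_int (by rwa [CircleDeg1Lift.coe_pow]) k
    rw [CircleDeg1Lift.coe_pow, ← iterate_mul, hi, iterate_add_apply] at hper
    rw [← CircleDeg1Lift.coe_pow, CircleDeg1Lift.map_add_int, CircleDeg1Lift.coe_pow, hper]
    push_cast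
    ring
  have hmono := f.monotone.iterate k
  rw [← hpre] at hk ⊢
  exact hmono (hgap i _ (hmono.reflect_lt hk))

end CircleLift

section PlateauMap

/-- The lift of the degree one circle map which agrees with `T_β` on the arc `[1 - 1/β, 1)` and is
constant on the complementary plateau `[0, 1 - 1/β]`; it makes the order-preserving dynamics of
`T_β` on that arc accessible to the theory of circle maps. -/
noncomputable def plateauMap (β x : ℝ) : ℝ := ⌊x⌋ + max (β * Int.fract x) (β - 1)

/-- The map `plateauMap β` bundled as a monotone map commuting with `x ↦ x + 1`. -/
noncomputable def plateauLift {β : ℝ} (hβ : 0 ≤ β) : CircleDeg1Lift where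
  toFun := plateauMap β
  monotone' x y hxy := by
    have hx := Int.floor_add_fract x
    have hy := Int.floor_add_fract y
    unfold plateauMap
    rcases (Int.floor_le_floor hxy).eq_or_lt with h | h
    · have hfract : Int.fract x ≤ Int.fract y := by
        rw [h] at hx
        linarith
      rw [h]
      gcongr
    · have hfloor : (⌊x⌋ : ℝ) + 1 ≤ ⌊y⌋ := by exact_mod_cast h
      have hle : max (β * Int.fract x) (β - 1) ≤ β :=
        max_le (mul_le_of_le_one_right hβ (Int.fract_lt_one x).le) (by linarith)
      linarith [le_max_right (β * Int.fract y) (β - 1)]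
  map_add_one' x := by
    simp only [plateauMap, Int.floor_add_one, Int.fract_add_one]
    push_cast
    ring

variable {β γ x y : ℝ} {m n : ℕ}

@[simp]
theorem coe_plateauLift (hβ : 0 ≤ β) : ⇑(plateauLift hβ) = plateauMap β := rfl

theorem monotone_plateauMap (hβ : 0 ≤ β) : Monotone (plateauMap β) := (plateauLift hβ).monotone

theorem plateauMap_iterate_add_int (hβ : 0 ≤ β) (n : ℕ) (x : ℝ) (k : ℤ) :
    (plateauMap β)^[n] (x + k) = (plateauMap β)^[n] x + k :=
  ((plateauLift hβ).commute_add_int k).iterate_left n x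

theorem continuous_plateauMap (hβ : 1 ≤ β) : Continuous (plateauMap β) := by
  have hdisp : Continuous ((fun u ↦ max (β * u) (β - 1) - u) ∘ Int.fract) :=
    ContinuousOn.comp_fract'' (by fun_prop) (by simp [hβ])
  convert continuous_id.add hdisp using 1
  funext x
  simp only [plateauMap, Pi.add_apply, id, comp_apply]
  linarith [Int.floor_add_fract x]

theorem mul_fract_le_plateauMap (β x : ℝ) : ⌊x⌋ + β * Int.fract x ≤ plateauMap β x := by
  unfold plateauMap
  gcongr
  exact le_max_left _ _

theorem plateauMap_of_le_fract (hβ : 0 < β) (hx : 1 - β⁻¹ ≤ Int.fract x) :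
    plateauMap β x = ⌊x⌋ + β * Int.fract x := by
  have hle : β - 1 ≤ β * Int.fract x :=
    calc β - 1 = β * (1 - β⁻¹) := by field_simp
      _ ≤ β * Int.fract x := by gcongr
  rw [plateauMap, max_eq_left hle]

theorem plateauMap_of_fract_le (hβ : 0 < β) (hx : Int.fract x ≤ 1 - β⁻¹) :
    plateauMap β x = ⌊x⌋ + (β - 1) := by
  have hle : β * Int.fract x ≤ β - 1 :=
    calc β * Int.fract x ≤ β * (1 - β⁻¹) := by gcongr
      _ = β - 1 := by field_simp
  rw [plateauMap, max_eq_right hle]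

theorem plateauMap_zero (hβ : 1 ≤ β) : plateauMap β 0 = β - 1 := by
  simp [plateauMap, hβ]

theorem plateauMap_iterate_of_fract_le (hβ : 1 ≤ β) (hx : Int.fract x ≤ 1 - β⁻¹) (hm : m ≠ 0) :
    (plateauMap β)^[m] x = (plateauMap β)^[m] 0 + ⌊x⌋ := by
  obtain ⟨m, rfl⟩ := Nat.exists_eq_succ_of_ne_zero hm
  have hβ₀ : 0 < β := by linarith
  rw [iterate_succ_apply, iterate_succ_apply, plateauMap_of_fract_le hβ₀ hx, plateauMap_zero hβ,
    add_comm, plateauMap_iterate_add_int hβ₀.le]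

theorem eventually_plateauMap_eq (hβ : 0 < β) (hx₀ : 0 < Int.fract x)
    (hx : Int.fract x < 1 - β⁻¹) : ∀ᶠ z in 𝓝 x, plateauMap β z = plateauMap β x := by
  have hx' := Int.floor_add_fract x
  filter_upwards [Ioo_mem_nhds (a := (⌊x⌋ : ℝ)) (b := ⌊x⌋ + (1 - β⁻¹)) (by linarith) (by linarith)]
    with z ⟨hz₁, hz₂⟩
  have hfloor : ⌊z⌋ = ⌊x⌋ := Int.floor_eq_iff.2 ⟨hz₁.le, by linarith [inv_pos.2 hβ]⟩
  have hfract : Int.fract z ≤ 1 - β⁻¹ := by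
    rw [← Int.self_sub_floor, hfloor]
    linarith
  rw [plateauMap_of_fract_le hβ hfract, plateauMap_of_fract_le hβ hx.le, hfloor]

theorem plateauMap_lt_plateauMap (hβ : 1 ≤ β) (hβγ : β < γ) (x : ℝ) :
    plateauMap β x < plateauMap γ x := by
  unfold plateauMap
  gcongr 1
  refine max_lt ?_ (lt_max_of_lt_right (by linarith))
  rcases (Int.fract_nonneg x).eq_or_lt' with h | h
  · rw [h, mul_zero]
    exact lt_max_of_lt_right (by linarith)
  · exact lt_max_of_lt_left (by gcongr)

theorem strictMonoOn_plateauMap_iterate (hn : n ≠ 0) (x : ℝ) :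
    StrictMonoOn (fun β ↦ (plateauMap β)^[n] x) (Ici 1) := by
  obtain ⟨n, rfl⟩ := Nat.exists_eq_succ_of_ne_zero hn
  intro β (hβ : 1 ≤ β) γ _ hβγ
  have hle : (plateauMap β)^[n] x ≤ (plateauMap γ)^[n] x :=
    (monotone_plateauMap (by linarith)).iterate_le_of_le
      (fun y ↦ (plateauMap_lt_plateauMap hβ hβγ y).le) n x
  simp only [iterate_succ_apply']
  exact (plateauMap_lt_plateauMap hβ hβγ _).trans_le (monotone_plateauMap (by linarith) hle)

theorem pow_mul_sub_le_plateauMap_iterate_sub (hβ : 0 < β) (hβγ : β ≤ γ)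
    (hfloor : ∀ i < n, ⌊(plateauMap β)^[i] x⌋ = ⌊(plateauMap γ)^[i] y⌋)
    (hx : ∀ i < n, 1 - β⁻¹ ≤ Int.fract ((plateauMap β)^[i] x)) :
    β ^ n * (y - x) ≤ (plateauMap γ)^[n] y - (plateauMap β)^[n] x := by
  induction n with
  | zero => simp
  | succ n ih =>
    have ih := ih (fun i hi ↦ hfloor i (by lia)) fun i hi ↦ hx i (by lia)
    have hfl := hfloor n n.lt_succ_self
    rw [iterate_succ_apply', iterate_succ_apply', plateauMap_of_le_fract hβ (hx n n.lt_succ_self)]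
    set u := (plateauMap β)^[n] x
    set v := (plateauMap γ)^[n] y
    calc β ^ (n + 1) * (y - x)
        = β * (β ^ n * (y - x)) := by ring
      _ ≤ β * (v - u) := by gcongr
      _ = ⌊v⌋ + β * Int.fract v - (⌊u⌋ + β * Int.fract u) := by
          rw [← Int.self_sub_floor, ← Int.self_sub_floor, hfl]
          ring
      _ ≤ ⌊v⌋ + γ * Int.fract v - (⌊u⌋ + β * Int.fract u) := by
          gcongr
      _ ≤ plateauMap γ v - (⌊u⌋ + β * Int.fract u) := by
          gcongr
          exact mul_fract_le_plateauMap γ v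

theorem exists_floor_plateauMap_iterate_lt (hβ : 1 < β) (hxy : x < y)
    (hx : ∀ i, 1 - β⁻¹ ≤ Int.fract ((plateauMap β)^[i] x)) :
    ∃ k, ⌊(plateauMap β)^[k] x⌋ < ⌊(plateauMap β)^[k] y⌋ := by
  by_contra! hle
  have hfloor (k : ℕ) : ⌊(plateauMap β)^[k] x⌋ = ⌊(plateauMap β)^[k] y⌋ :=
    (Int.floor_mono ((monotone_plateauMap (by linarith)).iterate k hxy.le)).antisymm (hle k)
  obtain ⟨k, hk⟩ := pow_unbounded_of_one_lt (y - x)⁻¹ hβ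
  have hexpand := pow_mul_sub_le_plateauMap_iterate_sub (n := k) (by linarith) le_rfl
    (fun i _ ↦ hfloor i) fun i _ ↦ hx i
  have hlt := (le_abs_self _).trans_lt (Int.abs_sub_lt_one_of_floor_eq_floor (hfloor k).symm)
  rw [inv_lt_iff_one_lt_mul₀ (sub_pos.2 hxy)] at hk
  linarith

end PlateauMap

section PlateauAvoiding

/-- The kneading condition that a perfect closure of `E_β^+` forces on `β`, up to countably many
exceptions: the orbit of the plateau never returns to the half-open plateau `[0, 1 - 1/β)`. -/
def PlateauAvoiding (β : ℝ) : Prop :=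
  ∀ n ≠ 0, 1 - β⁻¹ ≤ Int.fract ((plateauMap β)^[n] 0)

variable {β γ : ℝ} {N : ℕ}

theorem PlateauAvoiding.sub_le_inv_pow (hβ : 1 ≤ β) (hβγ : β ≤ γ) (h : PlateauAvoiding β)
    (hfloor : ∀ n ∈ Finset.Icc 1 (N + 1), ⌊(plateauMap β)^[n] 0⌋ = ⌊(plateauMap γ)^[n] 0⌋) :
    γ - β ≤ β⁻¹ ^ N := by
  have hexpand : β ^ N * (γ - β) ≤ (plateauMap γ)^[N + 1] 0 - (plateauMap β)^[N + 1] 0 :=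
    calc β ^ N * (γ - β)
        = β ^ N * (plateauMap γ 0 - plateauMap β 0) := by
          rw [plateauMap_zero hβ, plateauMap_zero (hβ.trans hβγ), sub_sub_sub_cancel_right]
      _ ≤ (plateauMap γ)^[N + 1] 0 - (plateauMap β)^[N + 1] 0 :=
          pow_mul_sub_le_plateauMap_iterate_sub (by linarith) hβγ
            (fun i hi ↦ hfloor (i + 1) (Finset.mem_Icc.2 ⟨by lia, by lia⟩))
            fun i _ ↦ h (i + 1) i.succ_ne_zero
  have hlt : |(plateauMap γ)^[N + 1] 0 - (plateauMap β)^[N + 1] 0| < 1 :=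
    Int.abs_sub_lt_one_of_floor_eq_floor (hfloor (N + 1) (by simp)).symm
  rw [inv_pow, ← one_div, le_div_iff₀' (by positivity)]
  exact hexpand.trans ((le_abs_self _).trans hlt.le)

theorem exists_floor_plateauMap_iterate_eq_div {M : ℕ} (hN : N ≠ 0) (hβ : 1 ≤ β)
    (hβM : β ≤ M + 1) :
    ∃ a ≤ N * M, ∃ b ≤ N, ∀ n ∈ Finset.Icc 1 N, ⌊(plateauMap β)^[n] 0⌋ = (n * a / b : ℕ) := by
  have hβ₀ : 0 ≤ β := by linarith
  simpa using exists_floor_iterate_sub_eq_div (plateauLift hβ₀) (x := 0) (M := M) hN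
    (by simp [plateauMap_zero hβ, hβ]) (by simp [plateauMap_zero hβ, hβM])

/-- The parameters in `S` whose plateau orbit has, up to time `N + 1`, the integer parts of the
orbit of `0` under the rotation by `a / b`. -/
def parameterCylinder (S : Set ℝ) (N a b : ℕ) : Set ℝ :=
  {β ∈ S | ∀ n ∈ Finset.Icc 1 (N + 1), ⌊(plateauMap β)^[n] 0⌋ = (n * a / b : ℕ)}

theorem ediam_parameterCylinder_le {S : Set ℝ} {c : ℝ} (hc : 1 ≤ c)
    (hS : ∀ β ∈ S, c ≤ β ∧ PlateauAvoiding β) (N a b : ℕ) :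
    ediam (parameterCylinder S N a b) ≤ ENNReal.ofReal (c⁻¹ ^ N) := by
  refine ediam_le_of_forall_dist_le fun β hβ γ hγ ↦ ?_
  wlog hβγ : β ≤ γ generalizing β γ
  · rw [dist_comm]
    exact this γ hγ β hβ (le_of_not_ge hβγ)
  obtain ⟨hcβ, hav⟩ := hS β hβ.1
  have hβ₀ : 0 ≤ β⁻¹ := inv_nonneg.2 (by linarith)
  rw [dist_comm, Real.dist_eq, abs_of_nonneg (sub_nonneg.2 hβγ)]
  calc γ - β ≤ β⁻¹ ^ N :=
        hav.sub_le_inv_pow (hc.trans hcβ) hβγ fun n hn ↦ (hβ.2 n hn).trans (hγ.2 n hn).symm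
    _ ≤ c⁻¹ ^ N := by gcongr

theorem dimH_setOf_plateauAvoiding_Icc {c : ℝ} (hc : 1 < c) (M : ℕ) :
    dimH {β | β ∈ Icc c (M + 1) ∧ PlateauAvoiding β} = 0 := by
  set S := {β : ℝ | β ∈ Icc c (M + 1) ∧ PlateauAvoiding β}
  have hcard : (fun N ↦ (Fintype.card (Fin ((N + 1) * M + 1) × Fin (N + 2)) : ℝ))
      =O[atTop] fun N : ℕ ↦ (N : ℝ) ^ 2 := by
    refine .of_bound (6 * M + 3) ?_
    filter_upwards [eventually_ge_atTop 1] with N hN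
    have hN' : (1 : ℝ) ≤ N := by exact_mod_cast hN
    simp only [Fintype.card_prod, Fintype.card_fin, Real.norm_eq_abs, Nat.abs_cast, abs_pow]
    push_cast
    calc (((N : ℝ) + 1) * M + 1) * (N + 2)
        ≤ ((N + N) * M + N) * (N + 2 * N) := by gcongr; linarith
      _ = (6 * M + 3) * N ^ 2 := by ring
  refine dimH_eq_zero_of_polynomial_cover (by positivity) (inv_lt_one_of_one_lt₀ hc) hcard
    (fun N p ↦ parameterCylinder S N p.1 p.2)
    (fun N p ↦ ediam_parameterCylinder_le hc.le (fun β hβ ↦ ⟨hβ.1.1, hβ.2⟩) N p.1 p.2)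
    fun N β hβ ↦ ?_
  obtain ⟨a, ha, b, hb, hab⟩ :=
    exists_floor_plateauMap_iterate_eq_div N.succ_ne_zero (hc.le.trans hβ.1.1) hβ.1.2
  exact mem_iUnion.2 ⟨(⟨a, by lia⟩, ⟨b, by lia⟩), hβ, hab⟩

theorem dimH_setOf_plateauAvoiding : dimH {β | 1 < β ∧ PlateauAvoiding β} = 0 := by
  have hsub : {β | 1 < β ∧ PlateauAvoiding β} ⊆
      ⋃ k : ℕ, ⋃ M : ℕ, {β | β ∈ Icc (1 + 1 / ((k : ℝ) + 1)) (M + 1) ∧ PlateauAvoiding β} := by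
    rintro β ⟨hβ, hav⟩
    obtain ⟨k, hk⟩ := exists_nat_one_div_lt (sub_pos.2 hβ)
    obtain ⟨M, hM⟩ := exists_nat_ge β
    exact mem_iUnion₂.2 ⟨k, M, ⟨by linarith, by linarith⟩, hav⟩
  refine le_antisymm ((dimH_mono hsub).trans ?_) bot_le
  simp only [dimH_iUnion]
  refine iSup₂_le fun k M ↦ (dimH_setOf_plateauAvoiding_Icc ?_ M).le
  exact lt_add_of_pos_right 1 Nat.one_div_pos_of_nat

theorem countable_setOf_fract_plateauMap_iterate_eq_zero :
    {β | 1 ≤ β ∧ ∃ n ≠ 0, Int.fract ((plateauMap β)^[n] 0) = 0}.Countable := by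
  have hsub : {β | 1 ≤ β ∧ ∃ n ≠ 0, Int.fract ((plateauMap β)^[n] 0) = 0} ⊆
      ⋃ n ∈ {n : ℕ | n ≠ 0}, ⋃ k : ℤ, {β | 1 ≤ β ∧ (plateauMap β)^[n] 0 = k} := by
    rintro β ⟨hβ, n, hn, h⟩
    obtain ⟨k, hk⟩ := Int.fract_eq_zero_iff.1 h
    exact mem_iUnion₂.2 ⟨n, hn, mem_iUnion.2 ⟨k, hβ, hk.symm⟩⟩
  refine .mono hsub (.biUnion (to_countable _) fun n hn ↦ countable_iUnion fun k ↦ ?_)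
  refine Subsingleton.countable fun β hβ γ hγ ↦ ?_
  exact (strictMonoOn_plateauMap_iterate hn 0).injOn hβ.1 hγ.1 (hβ.2.trans hγ.2.symm)

end PlateauAvoiding

section BetaMap

variable {β x : ℝ} {k : ℕ}

theorem fract_plateauMap (hβ : 0 < β) (hx : 1 - β⁻¹ ≤ Int.fract x) :
    Int.fract (plateauMap β x) = betaMap β (Int.fract x) := by
  rw [plateauMap_of_le_fract hβ hx, Int.fract_intCast_add, betaMap]

theorem betaMap_iterate_fract (hβ : 0 < β)
    (hx : ∀ i, 1 - β⁻¹ ≤ Int.fract ((plateauMap β)^[i] x)) (n : ℕ) :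
    (betaMap β)^[n] (Int.fract x) = Int.fract ((plateauMap β)^[n] x) := by
  induction n with
  | zero => rfl
  | succ n ih => rw [iterate_succ_apply', iterate_succ_apply', ih, fract_plateauMap hβ (hx n)]

theorem betaMap_iterate_of_mem_bifurcationSetPlus (hβ : 0 < β) (hx : x ∈ bifurcationSetPlus β)
    (hx₁ : 1 - β⁻¹ ≤ x) (n : ℕ) : (betaMap β)^[n] x = Int.fract ((plateauMap β)^[n] x) := by
  induction n with
  | zero => exact (Int.fract_eq_self.2 hx.1).symm
  | succ n ih =>
    have hn : 1 - β⁻¹ ≤ Int.fract ((plateauMap β)^[n] x) := (hx₁.trans (hx.2 n)).trans_eq ih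
    rw [iterate_succ_apply', iterate_succ_apply', ih, fract_plateauMap hβ hn]

theorem eventually_betaMap_eq (hx : betaMap β x ≠ 0) :
    ∀ᶠ z in 𝓝 x, betaMap β z = betaMap β x + β * (z - x) := by
  have hlt : (⌊β * x⌋ : ℝ) < β * x := by
    linarith [Int.fract_pos.2 fun h ↦ hx (Int.fract_eq_zero_iff.2 ⟨_, h.symm⟩),
      Int.floor_add_fract (β * x)]
  have hnhds : ∀ᶠ z in 𝓝 x, β * z ∈ Ioo (⌊β * x⌋ : ℝ) (⌊β * x⌋ + 1) :=
    (continuous_const_mul β).continuousAt.eventually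
      (Ioo_mem_nhds hlt (Int.lt_floor_add_one (β * x)))
  filter_upwards [hnhds] with z hz
  rw [betaMap, betaMap, ← Int.self_sub_floor, ← Int.self_sub_floor,
    Int.floor_eq_iff.2 ⟨hz.1.le, hz.2⟩]
  ring

theorem eventually_betaMap_iterate_eq (hx : ∀ i < k, (betaMap β)^[i + 1] x ≠ 0) :
    ∀ᶠ z in 𝓝 x, (betaMap β)^[k] z = (betaMap β)^[k] x + β ^ k * (z - x) := by
  induction k generalizing x with
  | zero => simp
  | succ k ih =>
    have hstep := eventually_betaMap_eq (hx 0 k.succ_pos)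
    have hcont : Tendsto (betaMap β) (𝓝 x) (𝓝 (betaMap β x)) := by
      refine Tendsto.congr' (hstep.mono fun z hz ↦ hz.symm) ?_
      exact Continuous.tendsto' (by fun_prop) _ _ (by simp)
    filter_upwards [hstep, hcont.eventually (ih fun i hi ↦ hx (i + 1) (by lia))] with z hz hz'
    rw [iterate_succ_apply, iterate_succ_apply, hz', hz]
    ring

end BetaMap

section PeriodicPoint

variable {β t s : ℝ} {m : ℕ}

theorem eventually_nhdsLT_notMem_bifurcationSetPlus (hβ : 1 < β) (hm : m ≠ 0)
    (ht : IsPeriodicPt (betaMap β) m t) (ht₀ : ∀ i, (betaMap β)^[i] t ≠ 0) :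
    ∀ᶠ s in 𝓝[<] t, s ∉ bifurcationSetPlus β := by
  filter_upwards [self_mem_nhdsWithin, nhdsWithin_le_nhds <|
    eventually_betaMap_iterate_eq (k := m) fun i _ ↦ ht₀ (i + 1)] with s (hst : s < t) hs hsE
  have hle := hsE.2 m
  rw [hs, ht.eq] at hle
  have hexpand : t - s < β ^ m * (t - s) :=
    lt_mul_of_one_lt_left (sub_pos.2 hst) (one_lt_pow₀ hβ hm)
  linarith

theorem notMem_bifurcationSetPlus_of_gap (hβ : 1 < β) (hm : m ≠ 0)
    (ht : IsPeriodicPt (betaMap β) m t) (htE : t ∈ bifurcationSetPlus β) (ht₁ : 1 - β⁻¹ ≤ t)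
    (hts : t < s) (hgap : ∀ i, t < (betaMap β)^[i] t → s ≤ (betaMap β)^[i] t) :
    s ∉ bifurcationSetPlus β := by
  intro hsE
  have hβ₀ : 0 < β := by linarith
  have hiter_t := betaMap_iterate_of_mem_bifurcationSetPlus hβ₀ htE ht₁
  have hiter_s := betaMap_iterate_of_mem_bifurcationSetPlus hβ₀ hsE (ht₁.trans hts.le)
  have ht_iter : (plateauMap β)^[m] t = t + ⌊(plateauMap β)^[m] t⌋ := by
    rw [← sub_eq_iff_eq_add, Int.self_sub_floor, ← hiter_t, ht.eq]
  have hgap_lift (i : ℕ) (j : ℤ) (hij : t < (plateauMap β)^[i] t + j) :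
      s ≤ (plateauMap β)^[i] t + j := by
    have hfract : Int.fract ((plateauMap β)^[i] t + j) = (betaMap β)^[i] t := by
      rw [Int.fract_add_intCast, hiter_t]
    rcases lt_or_ge ((plateauMap β)^[i] t + j) 1 with h | h
    · rw [Int.fract_eq_self.2 ⟨htE.1.1.trans hij.le, h⟩] at hfract
      rw [hfract] at hij ⊢
      exact hgap i hij
    · exact hsE.1.2.le.trans h
  obtain ⟨k, hk⟩ := exists_floor_plateauMap_iterate_lt hβ hts fun i ↦
    (ht₁.trans (htE.2 i)).trans_eq (hiter_t i)
  have hlt : (plateauMap β)^[k] t < t + ⌊(plateauMap β)^[k] s⌋ :=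
    (Int.floor_lt.1 hk).trans_le (le_add_of_nonneg_left htE.1.1)
  have hle : (plateauMap β)^[k] s ≤ t + ⌊(plateauMap β)^[k] s⌋ :=
    iterate_le_add_int_of_gap (plateauLift hβ₀.le) hm ht_iter hgap_lift hlt
  have hret : s ≤ Int.fract ((plateauMap β)^[k] s) := (hsE.2 k).trans_eq (hiter_s k)
  linarith [Int.self_sub_floor ((plateauMap β)^[k] s)]

theorem eventually_nhdsGT_notMem_bifurcationSetPlus (hβ : 1 < β) (hm : m ≠ 0)
    (ht : IsPeriodicPt (betaMap β) m t) (htE : t ∈ bifurcationSetPlus β) (ht₁ : 1 - β⁻¹ ≤ t) :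
    ∀ᶠ s in 𝓝[>] t, s ∉ bifurcationSetPlus β := by
  have hgap : ∀ᶠ s in 𝓝[>] t, ∀ i < m, t < (betaMap β)^[i] t → s ≤ (betaMap β)^[i] t := by
    refine (eventually_all_finite (finite_lt_nat m)).2 fun i _ ↦ ?_
    refine eventually_imp_distrib_left.2 fun hlt ↦ ?_
    exact nhdsWithin_le_nhds (eventually_le_nhds hlt)
  filter_upwards [self_mem_nhdsWithin, hgap] with s hts hs
  refine notMem_bifurcationSetPlus_of_gap hβ hm ht htE ht₁ hts fun i ↦ ?_
  rw [← ht.iterate_mod_apply]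
  exact hs _ (Nat.mod_lt i (pos_of_ne_zero hm))

theorem not_accPt_bifurcationSetPlus (hβ : 1 < β) (hm : m ≠ 0)
    (ht : IsPeriodicPt (betaMap β) m t) (htE : t ∈ bifurcationSetPlus β) (ht₁ : 1 - β⁻¹ ≤ t) :
    ¬ AccPt t (𝓟 (bifurcationSetPlus β)) := by
  have ht₀ (i : ℕ) : (betaMap β)^[i] t ≠ 0 :=
    ((sub_pos.2 (inv_lt_one_of_one_lt₀ hβ)).trans_le (ht₁.trans (htE.2 i))).ne'
  rw [accPt_iff_frequently_nhdsNE, not_frequently, ← nhdsLT_sup_nhdsGT, eventually_sup]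
  exact ⟨eventually_nhdsLT_notMem_bifurcationSetPlus hβ hm ht ht₀,
    eventually_nhdsGT_notMem_bifurcationSetPlus hβ hm ht htE ht₁⟩

theorem exists_iterate_mem_bifurcationSetPlus (hm : m ≠ 0) (ht : IsPeriodicPt (betaMap β) m t) :
    ∃ j, (betaMap β)^[j] t ∈ bifurcationSetPlus β := by
  obtain ⟨j, -, hmin⟩ := (Finset.range m).exists_min_image (fun i ↦ (betaMap β)^[i] t)
    (Finset.nonempty_range_iff.2 hm)
  have hrange : (betaMap β)^[j] t ∈ Ico (0 : ℝ) 1 := by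
    rw [← (ht.apply_iterate j).eq, ← Nat.succ_pred hm, iterate_succ_apply']
    exact ⟨Int.fract_nonneg _, Int.fract_lt_one _⟩
  refine ⟨j, hrange, fun n ↦ ?_⟩
  rw [← iterate_add_apply, ← ht.iterate_mod_apply (n + j)]
  exact hmin _ (Finset.mem_range.2 (Nat.mod_lt _ (pos_of_ne_zero hm)))

theorem not_preperfect_closure_of_isPeriodicPt (hβ : 1 < β) (hm : m ≠ 0)
    (ht : IsPeriodicPt (betaMap β) m t) (hplateau : ∀ i, 1 - β⁻¹ ≤ (betaMap β)^[i] t) :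
    ¬ Preperfect (closure (bifurcationSetPlus β)) := by
  intro hC
  obtain ⟨j, hj⟩ := exists_iterate_mem_bifurcationSetPlus hm ht
  refine not_accPt_bifurcationSetPlus hβ hm (ht.apply_iterate j) hj (hplateau j) ?_
  have hacc := hC _ (subset_closure hj)
  rwa [← mem_derivedSet, derivedSet_closure, mem_derivedSet] at hacc

end PeriodicPoint

section PlateauReturn

variable {β y : ℝ} {m : ℕ} {K : ℤ}

theorem fract_plateauMap_iterate_of_periodic (hβ : 1 ≤ β) (hm : m ≠ 0)
    (hy : (plateauMap β)^[m] y = y + K) {i : ℕ}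
    (hi : Int.fract ((plateauMap β)^[i] y) ≤ 1 - β⁻¹) :
    Int.fract ((plateauMap β)^[i] y) = Int.fract ((plateauMap β)^[m] 0) := by
  rw [← Int.fract_add_intCast _ K, ← plateauMap_iterate_add_int (by linarith), ← hy,
    ← iterate_add_apply, Nat.add_comm, iterate_add_apply, plateauMap_iterate_of_fract_le hβ hi hm,
    Int.fract_add_intCast]

theorem exists_first_plateauMap_periodic (hβ : 1 ≤ β) (hm : m ≠ 0)
    (h₀ : 0 < Int.fract ((plateauMap β)^[m] 0))
    (h₁ : Int.fract ((plateauMap β)^[m] 0) < 1 - β⁻¹) :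
    ∃ y > 1 - β⁻¹, (plateauMap β)^[m] y = y + ⌊(plateauMap β)^[m] 0⌋ ∧
      ∀ x ∈ Ico (1 - β⁻¹) y, (plateauMap β)^[m] x < x + ⌊(plateauMap β)^[m] 0⌋ := by
  have hβ₀ : 0 < β := by linarith
  have hβ' := inv_pos.2 hβ₀
  have hsplit := Int.floor_add_fract ((plateauMap β)^[m] 0)
  have hleft : (plateauMap β)^[m] (1 - β⁻¹) = (plateauMap β)^[m] 0 := by
    have hfloor : ⌊1 - β⁻¹⌋ = 0 := Int.floor_eq_zero_iff.2 ⟨by linarith, by linarith⟩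
    have hfract : Int.fract (1 - β⁻¹) ≤ 1 - β⁻¹ := by simp [← Int.self_sub_floor, hfloor]
    simpa [hfloor] using plateauMap_iterate_of_fract_le hβ hfract hm
  have hright : (plateauMap β)^[m] 1 = (plateauMap β)^[m] 0 + 1 := by
    simpa using plateauMap_iterate_add_int hβ₀.le m 0 1
  have hcont : Continuous fun x ↦ (plateauMap β)^[m] x - x :=
    ((continuous_plateauMap hβ).iterate m).sub continuous_id
  obtain ⟨y, hy, hyK, hfirst⟩ := exists_first_eq_of_continuousOn (a := 1 - β⁻¹) (b := 1)
    (c := (⌊(plateauMap β)^[m] 0⌋ : ℝ)) (by linarith) hcont.continuousOn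
    (by linarith) (by linarith)
  exact ⟨y, hy.1, by linarith, fun x hx ↦ by linarith [hfirst x hx]⟩

theorem exists_plateauMap_periodic_of_return (hβ : 1 ≤ β) (hm : m ≠ 0)
    (h₀ : 0 < Int.fract ((plateauMap β)^[m] 0))
    (h₁ : Int.fract ((plateauMap β)^[m] 0) < 1 - β⁻¹) :
    ∃ y, (plateauMap β)^[m] y = y + ⌊(plateauMap β)^[m] 0⌋ ∧
      ∀ i, 1 - β⁻¹ ≤ Int.fract ((plateauMap β)^[i] y) := by
  have hβ₀ : 0 < β := by linarith
  obtain ⟨y, hcy, hy, hfirst⟩ := exists_first_plateauMap_periodic hβ hm h₀ h₁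
  refine ⟨y, hy, fun i ↦ ?_⟩
  by_contra! hi
  have hconst : ∀ᶠ z in 𝓝 y, (plateauMap β)^[i + 1] z = (plateauMap β)^[i + 1] y := by
    have hpos : 0 < Int.fract ((plateauMap β)^[i] y) := by
      rwa [fract_plateauMap_iterate_of_periodic hβ hm hy hi.le]
    simp only [iterate_succ_apply']
    exact ((continuous_plateauMap hβ).iterate i).continuousAt.eventually
      (eventually_plateauMap_eq hβ₀ hpos hi)
  obtain ⟨x, hx_eq, hx⟩ :=
    ((hconst.filter_mono nhdsWithin_le_nhds).and (Ico_mem_nhdsLT hcy)).exists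
  exact (iterate_lt_iterate_of_map_le_of_le_map (plateauLift hβ₀.le) hm hx.2
    (hfirst x hx).le hy.ge (i + 1)).ne hx_eq

theorem plateauAvoiding_of_preperfect_closure (hβ : 1 < β)
    (h₀ : ∀ n ≠ 0, Int.fract ((plateauMap β)^[n] 0) ≠ 0)
    (hC : Preperfect (closure (bifurcationSetPlus β))) : PlateauAvoiding β := by
  intro m hm
  by_contra! hlt
  have hβ₀ : 0 < β := by linarith
  obtain ⟨y, hy, hplateau⟩ := exists_plateauMap_periodic_of_return hβ.le hm
    (Int.fract_nonneg _ |>.lt_of_ne' (h₀ m hm)) hlt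
  have hiter := betaMap_iterate_fract hβ₀ hplateau
  have hper : IsPeriodicPt (betaMap β) m (Int.fract y) := by
    rw [IsPeriodicPt, IsFixedPt, hiter, hy, Int.fract_add_intCast]
  exact not_preperfect_closure_of_isPeriodicPt hβ hm hper (fun i ↦ (hiter i).symm ▸ hplateau i) hC

end PlateauReturn

theorem theorem3_general :
    dimH {β : ℝ | 1 < β ∧ Preperfect (closure (bifurcationSetPlus β))} = 0 := by
  have hsub : {β : ℝ | 1 < β ∧ Preperfect (closure (bifurcationSetPlus β))} ⊆
      {β | 1 ≤ β ∧ ∃ n ≠ 0, Int.fract ((plateauMap β)^[n] 0) = 0} ∪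
        {β | 1 < β ∧ PlateauAvoiding β} := by
    rintro β ⟨hβ, hC⟩
    by_cases h : ∃ n ≠ 0, Int.fract ((plateauMap β)^[n] 0) = 0
    · exact .inl ⟨hβ.le, h⟩
    · push Not at h
      exact .inr ⟨hβ, plateauAvoiding_of_preperfect_closure hβ h hC⟩
  refine le_antisymm ((dimH_mono hsub).trans_eq ?_) bot_le
  rw [dimH_union, countable_setOf_fract_plateauMap_iterate_eq_zero.dimH_zero,
    dimH_setOf_plateauAvoiding, max_self]

theorem theorem3 :
    dimH {β : ℝ | β ∈ Set.Ioo (1 : ℝ) 2 ∧ IsCantorSet (closure (bifurcationSetPlus β))} = 0 := by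
  refine le_antisymm ((dimH_mono ?_).trans_eq theorem3_general) bot_le
  exact fun β hβ ↦ ⟨hβ.1.1, hβ.2.perfect.acc⟩
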